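/- Let $G=(V,E)$ be a finite simple directed planar graph with a fixed planar embedding, with arc capacities $c(e)\in[0,\infty]$, vertex capacities $c(v)\in[0,\infty]$, a source $s$ and a sink $t\neq s$ with $c(s)=c(t)=\infty$, such that $s$ has no incoming arcs, $t$ has no outgoing arcs, and $t$ lies on the boundary of the infinite face. Let the extended graph $G_e$ be obtained from $G$ by replacing every vertex $v$ of finite capacity and degree $d$ (the number of incoming and outgoing arcs) with a cycle $C_v$ on $d$ vertices $v_0,\dots,v_{d-1}$, in which $v_i$ and $v_{(i+1) \bmod d}$ are joined by an undirected edge of capacity $c(v)/2$ (that is, by two antiparallel arcs, both of capacity $c(v)/2$), and by attaching the arcs incident to $v$ to $v_0,\dots,v_{d-1}$, one arc to each vertex, in the same cyclic order. Arcs of $G$ are identified with the corresponding arcs of $G_e$ and keep their capacities; $G_e$ has no vertex capacities. For every arc $e$ of $G_e$ whose reverse $\mathrm{rev}(e)$ is not an arc, $\mathrm{rev}(e)$ is added, along the same curve, with capacity $0$. Given arc capacities, a flow function assigns to each arc a real number between $0$ and its capacity such that inflow equals outflow at every vertex other than the source and the sink; its value is the total flow that enters the sink. Let $f$ be a flow function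 in $G_e$. Define new capacities on $G_e$ by $c'(e)=f(e)$ for the arcs $e\in E$, $c'(e)=c(v)/2$ for the arcs of each $C_v$, and $c'(e)=0$ for the added reverse arcs. Let $f'$ be a flow function in $G_e$ with respect to $c'$, with the same value as $f$, such that $G_e$ has no clockwise residual cycle with respect to $f'$ and $c'$, that is, no clockwise simple cycle all of whose arcs $e$ have positive residual capacity $c'(e)-f'(e)+f'(\mathrm{rev}(e))$. Then the restriction $\hat{f'}$ of $f'$ to the arcs of $G$ has no counterclockwise flow-cycle: there is no counterclockwise simple cycle in $G$ such that $\hat{f'}(e)>0$ for each of its arcs $e$. Here a simple cycle is clockwise (counterclockwise) if the bounded region that it encloses lies on the right (left) of its arcs. -/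

import Mathlib

open scoped ENNReal

/-- A finite graph, possibly disconnected, with a combinatorial embedding in an oriented surface.
`D` is the type of darts: every edge is a pair `d`, `rev d` of oppositely directed darts that run
along the same curve, and `src d` is the vertex in which `d` starts. `rot d` is the dart that
follows `d` in counterclockwise order among the darts that start in `src d`. `F` is the type of
faces, `left d` is the face on the left of `d`, and `outer` is the infinite face. -/
structure EmbeddedGraph (V D F : Type*) where
  src : D → V
  rev : D → D
  rev_rev : ∀ d, rev (rev d) = d
  rev_ne : ∀ d, rev d ≠ d
  rot : Equiv.Perm D
  /-- The darts that start in a vertex form one cycle of `rot`. -/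
  src_eq_iff : ∀ d e, src d = src e ↔ rot.SameCycle d e
  left : D → F
  /-- The corner between `d` and the next dart `rot d` lies on the left of `d` and on the right of
  `rot d`. -/
  left_rev_rot : ∀ d, left (rev (rot d)) = left d
  outer : F

namespace EmbeddedGraph

variable {V D F : Type*} (M : EmbeddedGraph V D F)

/-- The vertex in which a dart ends. -/
def tgt (d : D) : V := M.src (M.rev d)

/-- The face on the right of a dart. -/
def right (d : D) : F := M.left (M.rev d)

/-- There is an edge from `u` to `v`. -/
def Adj (u v : V) : Prop := ∃ d, M.src d = u ∧ M.tgt d = v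

/-- Some edge that is not one of the edges of `C` separates the faces `a` and `b`. -/
def DualAdjAvoiding (C : Set D) (a b : F) : Prop :=
  ∃ d, d ∉ C ∧ M.rev d ∉ C ∧ M.left d = a ∧ M.right d = b

/-- The embedding is an embedding in the plane: the surface is connected (one can walk from any
face to any other one by crossing edges), and Euler's formula `|V| - |E| + |F| = 1 + c` holds,
where `c` is the number of connected components of the graph. The number of edges is `|D| / 2`, so
the formula is multiplied by two. -/
def IsPlanar : Prop :=
  (∀ a b : F, Relation.ReflTransGen (M.DualAdjAvoiding ∅) a b) ∧
    2 * (Nat.card V + Nat.card F) = Nat.card D + 2 * (1 + Nat.card (Quot M.Adj))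

/-- A (simple) directed cycle `C 0, C 1, …, C k`. The addition of `Fin (k + 1)` is cyclic. -/
def IsCycle {k : ℕ} (C : Fin (k + 1) → D) : Prop :=
  (∀ i, M.tgt (C i) = M.src (C (i + 1))) ∧ Function.Injective fun i => M.src (C i)

/-- The face `a` is enclosed by `C`: it cannot be reached from the infinite face without crossing
an edge of `C`. -/
def Encloses {k : ℕ} (C : Fin (k + 1) → D) (a : F) : Prop :=
  ¬ Relation.ReflTransGen (M.DualAdjAvoiding (Set.range C)) M.outer a

/-- The cycle `C` is clockwise: the region that it encloses lies on its right. -/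
def IsClockwise {k : ℕ} (C : Fin (k + 1) → D) : Prop :=
  M.IsCycle C ∧ ∀ i, M.Encloses C (M.right (C i))

/-- The cycle `C` is counterclockwise: the region that it encloses lies on its left. -/
def IsCounterclockwise {k : ℕ} (C : Fin (k + 1) → D) : Prop :=
  M.IsCycle C ∧ ∀ i, M.Encloses C (M.left (C i))

open Classical in
/-- The amount of `f` that enters `v`. -/
noncomputable def inflow [Fintype D] (f : D → ℝ) (v : V) : ℝ := ∑ d with M.tgt d = v, f d

open Classical in
/-- The amount of `f` that leaves `v`. -/
noncomputable def outflow [Fintype D] (f : D → ℝ) (v : V) : ℝ := ∑ d with M.src d = v, f d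

/-- `f` is a flow function from `s` to `t` with respect to the arc capacities `c` (there are no
vertex capacities). A dart that is not an arc of the graph has capacity `0`. -/
def IsFlow [Fintype D] (c : D → ℝ≥0∞) (s t : V) (f : D → ℝ) : Prop :=
  (∀ d, 0 ≤ f d ∧ ENNReal.ofReal (f d) ≤ c d) ∧
    ∀ v, v ≠ s → v ≠ t → M.inflow f v = M.outflow f v

/-- The residual capacity `c(e) - f(e) + f(rev(e))`. -/
noncomputable def resCap (c : D → ℝ≥0∞) (f : D → ℝ) (d : D) : EReal :=
  (c d : EReal) - (f d : EReal) + (f (M.rev d) : EReal)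

end EmbeddedGraph

/-- A simple directed plane graph with arc capacities, vertex capacities, a source and a sink.

Every arc is a dart, and every edge of the embedding carries an arc. Usually each arc has an edge of
its own, so that `rev` of it is an added arc of capacity `0`. Two antiparallel arcs may be drawn as
two edges; if both of their ends have infinite capacity, they may also share one edge. -/
structure PlanarNetwork (V D F : Type*) extends EmbeddedGraph V D F where
  isPlanar : toEmbeddedGraph.IsPlanar
  arcs : Set D
  arc_or_rev : ∀ d, d ∈ arcs ∨ rev d ∈ arcs
  no_loop : ∀ d, toEmbeddedGraph.tgt d ≠ src d
  no_parallel : ∀ d ∈ arcs, ∀ e ∈ arcs, src d = src e →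
    toEmbeddedGraph.tgt d = toEmbeddedGraph.tgt e → d = e
  /-- The capacities of the arcs. -/
  cap : D → ℝ≥0∞
  cap_of_notMem : ∀ d, d ∉ arcs → cap d = 0
  /-- The capacities of the vertices. -/
  vcap : V → ℝ≥0∞
  rev_notMem_of_vcap : ∀ d ∈ arcs, vcap (src d) ≠ ⊤ → rev d ∉ arcs
  rev_notMem_of_vcap' : ∀ d ∈ arcs, vcap (toEmbeddedGraph.tgt d) ≠ ⊤ → rev d ∉ arcs
  /-- The source. -/
  s : V
  /-- The sink. -/
  t : V
  s_ne_t : s ≠ t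
  vcap_s : vcap s = ⊤
  vcap_t : vcap t = ⊤
  /-- The source has no incoming arcs. -/
  tgt_ne_s : ∀ d ∈ arcs, toEmbeddedGraph.tgt d ≠ s
  /-- The sink has no outgoing arcs. -/
  src_ne_t : ∀ d ∈ arcs, src d ≠ t
  /-- The sink is on the boundary of the infinite face (unless it is an isolated vertex). -/
  t_outer : (∃ d, src d = t) → ∃ d, src d = t ∧ left d = outer

namespace PlanarNetwork

variable {V D F : Type*} (N : PlanarNetwork V D F)

/-- The darts that start in a vertex of finite capacity. -/
abbrev FinDart : Type _ := {d : D // N.vcap (N.src d) ≠ ⊤}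

/-- The vertices of the extended graph: the vertices of infinite capacity, and for every vertex `v`
of finite capacity one vertex for each dart `d` that starts in `v`. -/
abbrev ExtVertex : Type _ := {v : V // N.vcap v = ⊤} ⊕ N.FinDart

/-- The darts of the extended graph: those of the graph, and for each dart `a` that starts in a
vertex `v` of finite capacity the two darts of an edge of the cycle `C_v`; `(a, true)` goes
(counterclockwise along `C_v`) from the vertex of `a` to the vertex of `rot a`, and `(a, false)`
goes back. -/
abbrev ExtDart : Type _ := D ⊕ (N.FinDart × Bool)

/-- The faces of the extended graph: those of the graph, and the disc inside each cycle `C_v`. -/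
abbrev ExtFace : Type _ := F ⊕ {v : V // N.vcap v ≠ ⊤ ∧ ∃ d, N.src d = v}

theorem src_rot (d : D) : N.src (N.rot d) = N.src d :=
  (N.src_eq_iff _ _).2 (Equiv.Perm.SameCycle.refl _ _).apply_left

theorem src_rot_symm (d : D) : N.src (N.rot.symm d) = N.src d := by
  rw [← N.src_rot, Equiv.apply_symm_apply]

/-- The next dart around the same vertex of finite capacity. -/
def finRot (a : N.FinDart) : N.FinDart := ⟨N.rot a.1, by rw [N.src_rot]; exact a.2⟩

/-- The previous dart around the same vertex of finite capacity. -/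
def finRotSymm (a : N.FinDart) : N.FinDart := ⟨N.rot.symm a.1, by rw [N.src_rot_symm]; exact a.2⟩

@[simp] theorem finRot_finRotSymm (a : N.FinDart) : N.finRot (N.finRotSymm a) = a :=
  Subtype.ext (by simp [finRot, finRotSymm])

@[simp] theorem finRotSymm_finRot (a : N.FinDart) : N.finRotSymm (N.finRot a) = a :=
  Subtype.ext (by simp [finRot, finRotSymm])

open Classical in
noncomputable def extSrc : N.ExtDart → N.ExtVertex
  | Sum.inl d => if h : N.vcap (N.src d) = ⊤ then Sum.inl ⟨N.src d, h⟩ else Sum.inr ⟨d, h⟩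
  | Sum.inr (a, true) => Sum.inr a
  | Sum.inr (a, false) => Sum.inr (N.finRot a)

def extRev : N.ExtDart → N.ExtDart
  | Sum.inl d => Sum.inl (N.rev d)
  | Sum.inr (a, b) => Sum.inr (a, !b)

open Classical in
/-- Around a vertex of `C_v` that belongs to the dart `a`, the counterclockwise order is: `a`, the
edge of `C_v` to the vertex of `rot a`, the edge of `C_v` to the vertex of `rot⁻¹ a`. -/
noncomputable def extRot : Equiv.Perm N.ExtDart where
  toFun
    | Sum.inl d => if h : N.vcap (N.src d) = ⊤ then Sum.inl (N.rot d) else Sum.inr (⟨d, h⟩, true)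
    | Sum.inr (a, true) => Sum.inr (N.finRotSymm a, false)
    | Sum.inr (a, false) => Sum.inl (N.finRot a).1
  invFun
    | Sum.inl d => if h : N.vcap (N.src d) = ⊤ then Sum.inl (N.rot.symm d)
        else Sum.inr (N.finRotSymm ⟨d, h⟩, false)
    | Sum.inr (a, true) => Sum.inl a.1
    | Sum.inr (a, false) => Sum.inr (N.finRot a, true)
  left_inv x := by
    rcases x with d | ⟨a, _ | _⟩
    · by_cases h : N.vcap (N.src d) = ⊤ <;> simp [h, N.src_rot]
    · simp [(N.finRot a).2]
    · simp
  right_inv x := by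
    rcases x with d | ⟨a, _ | _⟩
    · by_cases h : N.vcap (N.src d) = ⊤ <;> simp [h, N.src_rot_symm]
    · simp
    · simp [a.2]

def extLeft : N.ExtDart → N.ExtFace
  | Sum.inl d => Sum.inl (N.left d)
  | Sum.inr (a, true) => Sum.inr ⟨N.src a.1, a.2, a.1, rfl⟩
  | Sum.inr (a, false) => Sum.inl (N.left a.1)

theorem extRot_inl_of_eq {d : D} (h : N.vcap (N.src d) = ⊤) :
    N.extRot (Sum.inl d) = Sum.inl (N.rot d) := by simp [extRot, h]

theorem extRot_inl_of_ne {d : D} (h : N.vcap (N.src d) ≠ ⊤) :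
    N.extRot (Sum.inl d) = Sum.inr (⟨d, h⟩, true) := by simp [extRot, h]

theorem extRot_true (a : N.FinDart) :
    N.extRot (Sum.inr (a, true)) = Sum.inr (N.finRotSymm a, false) := rfl

theorem extRot_false (a : N.FinDart) :
    N.extRot (Sum.inr (a, false)) = Sum.inl (N.finRot a).1 := rfl

theorem extSrc_extRot (x : N.ExtDart) : N.extSrc (N.extRot x) = N.extSrc x := by
  rcases x with d | ⟨a, _ | _⟩
  · by_cases h : N.vcap (N.src d) = ⊤
    · simp [N.extRot_inl_of_eq h, extSrc, N.src_rot, h]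
    · simp [N.extRot_inl_of_ne h, extSrc, h]
  · simp [extRot_false, extSrc, (N.finRot a).2]
  · simp [extRot_true, extSrc]

theorem extSrc_of_sameCycle {x y : N.ExtDart} (h : N.extRot.SameCycle x y) :
    N.extSrc x = N.extSrc y := by
  obtain ⟨n, rfl⟩ := h
  induction n with
  | zero => simp
  | succ n ih => rw [add_comm, zpow_add, zpow_one, Equiv.Perm.mul_apply, extSrc_extRot, ih]
  | pred n ih =>
    rw [ih, ← N.extSrc_extRot ((N.extRot ^ (-(n : ℤ) - 1)) x), ← Equiv.Perm.mul_apply,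
      ← zpow_one_add]
    congr 3
    ring

/-- Every dart of the extended graph has, around its source, a dart of the graph. -/
theorem exists_inl_sameCycle (x : N.ExtDart) : ∃ d, N.extRot.SameCycle x (Sum.inl d) := by
  rcases x with d | ⟨a, _ | _⟩
  · exact ⟨d, Equiv.Perm.SameCycle.refl _ _⟩
  · exact ⟨(N.finRot a).1, 1, by rw [zpow_one, extRot_false]⟩
  · refine ⟨a.1, 2, ?_⟩
    rw [zpow_two, Equiv.Perm.mul_apply, extRot_true, extRot_false, finRot_finRotSymm]

theorem extRot_sameCycle_inl {d e : D} (h : N.vcap (N.src d) = ⊤) (hde : N.rot.SameCycle d e) :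
    N.extRot.SameCycle (Sum.inl d) (Sum.inl e) := by
  have key : ∀ x : D, N.vcap (N.src x) = ⊤ →
      N.extRot.SameCycle (Sum.inl x) (Sum.inl (N.rot x)) := fun x hx =>
    ⟨1, by rw [zpow_one, N.extRot_inl_of_eq hx]⟩
  obtain ⟨n, rfl⟩ := hde
  have hs : ∀ m : ℤ, N.src ((N.rot ^ m) d) = N.src d := fun m =>
    ((N.src_eq_iff _ _).2 ⟨m, rfl⟩).symm
  induction n with
  | zero => simpa using Equiv.Perm.SameCycle.refl _ _
  | succ n ih =>
    refine ih.trans ?_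
    rw [add_comm, zpow_add, zpow_one, Equiv.Perm.mul_apply]
    exact key _ (by rw [hs]; exact h)
  | pred n ih =>
    refine ih.trans ?_
    have := key ((N.rot ^ (-(n : ℤ) - 1)) d) (by rw [hs]; exact h)
    rw [← Equiv.Perm.mul_apply, ← zpow_one_add] at this
    rw [show (1 : ℤ) + (-(n : ℤ) - 1) = -n by ring] at this
    exact this.symm

theorem extSrc_eq_iff (x y : N.ExtDart) :
    N.extSrc x = N.extSrc y ↔ N.extRot.SameCycle x y := by
  refine ⟨fun hxy => ?_, N.extSrc_of_sameCycle⟩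
  obtain ⟨d, hd⟩ := N.exists_inl_sameCycle x
  obtain ⟨e, he⟩ := N.exists_inl_sameCycle y
  rw [N.extSrc_of_sameCycle hd, N.extSrc_of_sameCycle he] at hxy
  refine hd.trans (Equiv.Perm.SameCycle.trans ?_ he.symm)
  by_cases h : N.vcap (N.src d) = ⊤ <;> by_cases h' : N.vcap (N.src e) = ⊤
  · simp only [extSrc, h, h', dif_pos, Sum.inl.injEq, Subtype.mk.injEq] at hxy
    exact N.extRot_sameCycle_inl h ((N.src_eq_iff _ _).1 hxy)
  · simp [extSrc, h, h'] at hxy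
  · simp [extSrc, h, h'] at hxy
  · simp only [extSrc, h, h', dif_neg, not_false_eq_true, Sum.inr.injEq, Subtype.mk.injEq] at hxy
    rw [hxy]

/-- The extended graph: every vertex `v` of finite capacity and degree `n` is replaced by a cycle
`C_v` of length `n`, and the darts that start in `v` are attached to the vertices of `C_v`, one to
each, in the same cyclic order. -/
noncomputable def extGraph : EmbeddedGraph N.ExtVertex N.ExtDart N.ExtFace where
  src := N.extSrc
  rev := N.extRev
  rev_rev x := by rcases x with d | ⟨a, b⟩ <;> simp [extRev, N.rev_rev]
  rev_ne x := by rcases x with d | ⟨a, b⟩ <;> simp [extRev, N.rev_ne]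
  rot := N.extRot
  src_eq_iff := N.extSrc_eq_iff
  left := N.extLeft
  left_rev_rot x := by
    rcases x with d | ⟨a, _ | _⟩
    · by_cases h : N.vcap (N.src d) = ⊤
      · rw [N.extRot_inl_of_eq h]; simp [extRev, extLeft, N.left_rev_rot]
      · rw [N.extRot_inl_of_ne h]; simp [extRev, extLeft]
    · rw [N.extRot_false]; simp [extRev, extLeft, finRot, N.left_rev_rot]
    · rw [N.extRot_true]; simp [extRev, extLeft, finRotSymm, N.src_rot_symm]
  outer := Sum.inl N.outer

/-- The source of the extended graph. -/
def extS : N.ExtVertex := Sum.inl ⟨N.s, N.vcap_s⟩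

/-- The sink of the extended graph. -/
def extT : N.ExtVertex := Sum.inl ⟨N.t, N.vcap_t⟩

/-- The capacities of the extended graph: both darts of an edge of `C_v` have capacity
`c(v) / 2`. -/
noncomputable def extCap : N.ExtDart → ℝ≥0∞
  | Sum.inl d => N.cap d
  | Sum.inr (a, _) => N.vcap (N.src a.1) / 2

open Classical in
/-- The capacities `c'` that belong to a flow `f` in the extended graph: `c'(e) = f(e)` for the arcs
`e` of the original graph, `c'(e) = c(v) / 2` for the darts of `C_v`, and `c'(e) = 0` for the added
reverse darts. -/
noncomputable def cappedCap (f : N.ExtDart → ℝ) : N.ExtDart → ℝ≥0∞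
  | Sum.inl d => if d ∈ N.arcs then ENNReal.ofReal (f (Sum.inl d)) else 0
  | Sum.inr (a, _) => N.vcap (N.src a.1) / 2

/-- The restriction of a function on the darts of the extended graph to the original graph. -/
def restrict (f : N.ExtDart → ℝ) : D → ℝ := fun d => f (Sum.inl d)

/-- `C` is a flow-cycle of `g` in the original graph: a cycle of arcs on which `g` is positive. -/
def IsFlowCycle {k : ℕ} (g : D → ℝ) (C : Fin (k + 1) → D) : Prop :=
  N.IsCycle C ∧ ∀ i, C i ∈ N.arcs ∧ 0 < g (C i)

end PlanarNetwork

/-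
Write `g` for the restriction of `f'` to `G`.

In a plane graph every circulation is the coboundary of a potential on the faces; Euler's formula
gives this by a dimension count, and the extended graph inherits it from `G`. Suppose that `g` has
a counterclockwise flow-cycle, and let `S` be the set of darts with `g > 0` in its strongly
connected component. Some circulation is positive exactly on `S`, and the enclosed faces at which
its potential is maximal form a set `Ψ` that can only be left by crossing a dart of `S` from left
to right. Flow that leaves the component into `Ψ` would never return and would have to be absorbed,
but `t` lies on the infinite face, hence not within `Ψ`. So all flow on the edges from the
component into `Ψ` enters the component.

On the other hand, without clockwise residual cycles every face of `G_e` can be reached from the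
infinite face by crossing saturated darts from left to right: otherwise the boundary of the set of
reachable faces contains a clockwise residual cycle. But `Ψ`, together with the discs of those
`C_v` that it surrounds, cannot be entered in this way. The only critical case is a saturated
counterclockwise dart of some `C_v` that separates `Ψ` from the disc. Going on counterclockwise
around `v` through `Ψ`, flow can only enter `C_v`, so its net flow cannot decrease, and being
maximal already it stays constant; hence no dart of `S` is ever met and `Ψ` surrounds `v`.
-/

lemma exists_mem_periodicPts_of_finite {α : Type*} [Finite α] [Nonempty α] (g : α → α) :
    ∃ x, x ∈ Function.periodicPts g := by
  obtain ⟨x₀⟩ := ‹Nonempty α›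
  obtain ⟨m, n, hmn, heq⟩ := Finite.exists_ne_map_eq_of_infinite fun n : ℕ => g^[n] x₀
  wlog hlt : m < n generalizing m n
  · exact this n m hmn.symm heq.symm (hmn.lt_or_gt.resolve_left hlt)
  refine ⟨g^[m] x₀, Function.mk_mem_periodicPts (Nat.sub_pos_of_lt hlt) ?_⟩
  rw [Function.IsPeriodicPt, Function.IsFixedPt, ← Function.iterate_add_apply,
    Nat.sub_add_cancel hlt.le]
  exact heq.symm

namespace EmbeddedGraph

variable {V D F : Type*} (M : EmbeddedGraph V D F)

@[simp] lemma left_rev (d : D) : M.left (M.rev d) = M.right d := rfl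

@[simp] lemma right_rev (d : D) : M.right (M.rev d) = M.left d := by rw [right, M.rev_rev]

@[simp] lemma src_rev (d : D) : M.src (M.rev d) = M.tgt d := rfl

@[simp] lemma tgt_rev (d : D) : M.tgt (M.rev d) = M.src d := by rw [tgt, M.rev_rev]

@[simp] lemma right_rot (d : D) : M.right (M.rot d) = M.left d := M.left_rev_rot d

@[simp] lemma src_rot (d : D) : M.src (M.rot d) = M.src d :=
  (M.src_eq_iff _ _).2 (Equiv.Perm.SameCycle.refl _ _).apply_left

variable {M} in
lemma rot_induction [Finite D] {p : D → Prop} {d e : D}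
    (hp : ∀ x, M.src x = M.src d → p x → p (M.rot x)) (hd : p d) (he : M.src e = M.src d) :
    p e := by
  obtain ⟨n, -, rfl⟩ := ((M.src_eq_iff d e).1 he.symm).exists_pow_eq'
  suffices ∀ n : ℕ, M.src ((M.rot ^ n) d) = M.src d ∧ p ((M.rot ^ n) d) from (this n).2
  intro n
  induction n with
  | zero => exact ⟨rfl, hd⟩
  | succ n ih =>
    rw [pow_succ', Equiv.Perm.mul_apply, src_rot]
    exact ⟨ih.1, hp _ ih.1 ih.2⟩

/-! ### Flows and circulations -/

/-- The net flow along a dart, where the flow along the reverse dart counts negative. -/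
def net (f : D → ℝ) (d : D) : ℝ := f d - f (M.rev d)

/-- The divergence of a function on the darts: the amount that leaves a vertex minus the amount that
enters it. -/
noncomputable def divergence [Fintype D] : (D → ℝ) →ₗ[ℝ] (V → ℝ) where
  toFun f v := M.outflow f v - M.inflow f v
  map_add' f g := by
    ext v
    simp only [outflow, inflow, Pi.add_apply, Finset.sum_add_distrib]
    ring
  map_smul' a f := by
    ext v
    simp only [outflow, inflow, Pi.smul_apply, smul_eq_mul, RingHom.id_apply, ← Finset.mul_sum,
      mul_sub]

lemma divergence_apply [Fintype D] (f : D → ℝ) (v : V) :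
    M.divergence f v = M.outflow f v - M.inflow f v := rfl

variable {M} in
lemma IsFlow.divergence_eq_zero [Fintype D] {c : D → ℝ≥0∞} {s t : V} {f : D → ℝ}
    (hf : M.IsFlow c s t f) {v : V} (hs : v ≠ s) (ht : v ≠ t) : M.divergence f v = 0 := by
  rw [divergence_apply, hf.2 v hs ht, sub_self]

lemma inflow_eq_outflow_comp_rev [Fintype D] (f : D → ℝ) (v : V) :
    M.inflow f v = M.outflow (f ∘ M.rev) v := by
  classical
  rw [inflow, outflow, Finset.sum_filter, Finset.sum_filter,
    ← Equiv.sum_comp (Function.Involutive.toPerm M.rev M.rev_rev)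
      fun d => if M.tgt d = v then f d else 0]
  exact Finset.sum_congr rfl fun d _ => if_congr (by rw [← M.tgt_rev]; rfl) rfl rfl

lemma divergence_eq_outflow_net [Fintype D] (f : D → ℝ) (v : V) :
    M.divergence f v = M.outflow (M.net f) v := by
  rw [divergence_apply, inflow_eq_outflow_comp_rev, outflow, outflow, ← Finset.sum_sub_distrib]
  rfl

lemma outflow_comp_rot [Fintype D] (f : D → ℝ) (v : V) :
    M.outflow (f ∘ M.rot) v = M.outflow f v := by
  classical
  rw [outflow, outflow, Finset.sum_filter, Finset.sum_filter,
    ← Equiv.sum_comp M.rot fun d => if M.src d = v then f d else 0]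
  simp only [src_rot, Function.comp_apply]

lemma divergence_single [Fintype D] [DecidableEq D] [DecidableEq V] (d : D) :
    M.divergence (Pi.single d 1) = Pi.single (M.src d) 1 - Pi.single (M.tgt d) 1 := by
  ext v
  simp [divergence_apply, outflow, inflow, Pi.single_apply, eq_comm]

/-! ### Potentials -/

/-- The antisymmetric functions on the darts. -/
def antisymm : Submodule ℝ (D → ℝ) where
  carrier := {x | ∀ d, x (M.rev d) = -x d}
  add_mem' ha hb d := by rw [Pi.add_apply, ha d, hb d, Pi.add_apply, neg_add]
  zero_mem' _ := neg_zero.symm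
  smul_mem' c x hx d := by rw [Pi.smul_apply, hx d, smul_neg, Pi.smul_apply]

lemma net_mem_antisymm (f : D → ℝ) : M.net f ∈ M.antisymm := fun d => by
  rw [net, net, M.rev_rev, neg_sub]

variable {M} in
lemma divergence_of_mem_antisymm [Fintype D] {x : D → ℝ} (hx : x ∈ M.antisymm) :
    M.divergence x = (2 : ℝ) • M.outflow x := by
  have hrev : x ∘ M.rev = -x := funext hx
  ext v
  rw [divergence_apply, inflow_eq_outflow_comp_rev, hrev]
  simp only [outflow, Pi.neg_apply, Finset.sum_neg_distrib, Pi.smul_apply, smul_eq_mul]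
  ring

lemma exists_orientation [Fintype D] :
    ∃ O : Finset D, (∀ d, d ∈ O ∨ M.rev d ∈ O) ∧ 2 * O.card = Fintype.card D := by
  classical
  let r := Fintype.equivFin D
  let O : Finset D := {d | r d < r (M.rev d)}
  have hne (d : D) : r d ≠ r (M.rev d) := r.injective.ne (M.rev_ne d).symm
  have hcompl : O.map (Function.Involutive.toPerm M.rev M.rev_rev).toEmbedding = Oᶜ := by
    ext d
    rw [Finset.mem_map_equiv, Finset.mem_filter_univ, Finset.mem_compl, Finset.mem_filter_univ,
      not_lt, (hne d).symm.le_iff_lt]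
    change r (M.rev d) < r (M.rev (M.rev d)) ↔ _
    rw [M.rev_rev]
  refine ⟨O, fun d => ?_, ?_⟩
  · simpa [O, M.rev_rev] using (hne d).lt_or_gt
  · rw [two_mul, ← O.card_add_card_compl, ← hcompl, Finset.card_map]

lemma two_mul_finrank_antisymm_le [Fintype D] :
    2 * Module.finrank ℝ M.antisymm ≤ Fintype.card D := by
  obtain ⟨O, hO, hcard⟩ := M.exists_orientation
  let res : M.antisymm →ₗ[ℝ] (O → ℝ) :=
    (LinearMap.funLeft ℝ ℝ (Subtype.val : O → D)).comp M.antisymm.subtype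
  have hinj : Function.Injective res := by
    rw [← LinearMap.ker_eq_bot, LinearMap.ker_eq_bot']
    rintro ⟨x, hx⟩ h
    ext d
    have hzero (e : D) (he : e ∈ O) : x e = 0 := congrFun h ⟨e, he⟩
    rcases hO d with hd | hd
    · exact hzero d hd
    · exact neg_eq_zero.1 ((hx d).symm.trans (hzero _ hd))
  have hle := LinearMap.finrank_le_finrank_of_injective hinj
  rw [Module.finrank_fintype_fun_eq_card, Fintype.card_coe] at hle
  lia

/-- The coboundary of a function on the vertices. -/
def vertexCoboundary : (V → ℝ) →ₗ[ℝ] (D → ℝ) :=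
  LinearMap.funLeft ℝ ℝ M.src - LinearMap.funLeft ℝ ℝ M.tgt

/-- The coboundary of a function on the faces. -/
def faceCoboundary : (F → ℝ) →ₗ[ℝ] (D → ℝ) :=
  LinearMap.funLeft ℝ ℝ M.left - LinearMap.funLeft ℝ ℝ M.right

lemma vertexCoboundary_apply (p : V → ℝ) (d : D) :
    M.vertexCoboundary p d = p (M.src d) - p (M.tgt d) := rfl

lemma faceCoboundary_apply (φ : F → ℝ) (d : D) :
    M.faceCoboundary φ d = φ (M.left d) - φ (M.right d) := rfl

lemma range_vertexCoboundary_le_antisymm : LinearMap.range M.vertexCoboundary ≤ M.antisymm := by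
  rintro _ ⟨p, rfl⟩ d
  simp [vertexCoboundary_apply]

lemma range_faceCoboundary_le_antisymm : LinearMap.range M.faceCoboundary ≤ M.antisymm := by
  rintro _ ⟨φ, rfl⟩ d
  simp [faceCoboundary_apply]

lemma range_faceCoboundary_le_ker_divergence [Fintype D] :
    LinearMap.range M.faceCoboundary ≤ LinearMap.ker M.divergence := by
  rintro _ ⟨φ, rfl⟩
  have houtflow (v : V) : M.outflow (M.faceCoboundary φ) v = 0 := by
    have hrot : (φ ∘ M.right) ∘ M.rot = φ ∘ M.left := funext fun d => congrArg φ (M.right_rot d)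
    have hcomp := M.outflow_comp_rot (φ ∘ M.right) v
    rw [hrot, ← sub_eq_zero, outflow, outflow, ← Finset.sum_sub_distrib] at hcomp
    exact hcomp
  rw [LinearMap.mem_ker, divergence_of_mem_antisymm (M.range_faceCoboundary_le_antisymm ⟨φ, rfl⟩)]
  ext v
  simp [houtflow]

lemma sum_mul_vertexCoboundary [Fintype V] [Fintype D] (f : D → ℝ) (p : V → ℝ) :
    ∑ d, f d * M.vertexCoboundary p d = ∑ v, M.divergence f v * p v := by
  classical
  have hfiber (h : D → V) : ∑ v, (∑ d with h d = v, f d) * p v = ∑ d, f d * p (h d) := by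
    rw [← Finset.sum_fiberwise Finset.univ h]
    refine Finset.sum_congr rfl fun v _ => ?_
    rw [Finset.sum_mul]
    exact Finset.sum_congr rfl fun d hd => by rw [(Finset.mem_filter.1 hd).2]
  simp only [vertexCoboundary_apply, divergence_apply, mul_sub, sub_mul, Finset.sum_sub_distrib,
    ← hfiber]
  congr!

lemma disjoint_range_vertexCoboundary_ker_divergence [Finite V] [Fintype D] :
    Disjoint (LinearMap.range M.vertexCoboundary) (LinearMap.ker M.divergence) := by
  have := Fintype.ofFinite V
  rw [Submodule.disjoint_def]
  rintro _ ⟨p, rfl⟩ hp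
  have hsum := M.sum_mul_vertexCoboundary (M.vertexCoboundary p) p
  simp only [LinearMap.mem_ker.1 hp, Pi.zero_apply, zero_mul, Finset.sum_const_zero] at hsum
  rw [Finset.sum_eq_zero_iff_of_nonneg fun d _ => mul_self_nonneg _] at hsum
  exact funext fun d => mul_self_eq_zero.1 (hsum d (Finset.mem_univ d))

variable {M} in
lemma eq_of_reflTransGen_dualAdjAvoiding {α : Type*} {S : Set D} {φ : F → α}
    (hφ : ∀ d, d ∉ S → M.rev d ∉ S → φ (M.left d) = φ (M.right d)) {a b : F}
    (hab : Relation.ReflTransGen (M.DualAdjAvoiding S) a b) : φ a = φ b := by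
  induction hab with
  | refl => rfl
  | tail _ hstep ih =>
    obtain ⟨d, hd, hd', rfl, rfl⟩ := hstep
    exact ih.trans (hφ d hd hd')

lemma finrank_ker_vertexCoboundary_le [Finite V] :
    Module.finrank ℝ (LinearMap.ker M.vertexCoboundary) ≤ Nat.card (Quot M.Adj) := by
  have := Fintype.ofFinite (Quot M.Adj)
  have hle : LinearMap.ker M.vertexCoboundary ≤
      LinearMap.range (LinearMap.funLeft ℝ ℝ (Quot.mk M.Adj)) := by
    intro p hp
    refine ⟨Quot.lift p ?_, rfl⟩
    rintro _ _ ⟨d, rfl, rfl⟩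
    exact sub_eq_zero.1 (congrFun (LinearMap.mem_ker.1 hp) d)
  rw [Nat.card_eq_fintype_card, ← Module.finrank_fintype_fun_eq_card ℝ]
  exact (Submodule.finrank_mono hle).trans (LinearMap.finrank_range_le _)

variable {M} in
lemma finrank_ker_faceCoboundary_le_one
    (hconn : ∀ a b : F, Relation.ReflTransGen (M.DualAdjAvoiding ∅) a b) :
    Module.finrank ℝ (LinearMap.ker M.faceCoboundary) ≤ 1 := by
  refine finrank_le_one ⟨fun _ => 1, by ext d; simp [faceCoboundary_apply]⟩ ?_
  rintro ⟨φ, hφ⟩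
  refine ⟨φ M.outer, Subtype.ext (funext fun a => ?_)⟩
  have hconst : φ M.outer = φ a := eq_of_reflTransGen_dualAdjAvoiding
    (fun d _ _ => sub_eq_zero.1 (congrFun (LinearMap.mem_ker.1 hφ) d)) (hconn M.outer a)
  simpa using hconst

variable {M} in
lemma IsPlanar.range_vertexCoboundary_sup_range_faceCoboundary [Finite V] [Finite D] [Finite F]
    (hM : M.IsPlanar) :
    LinearMap.range M.vertexCoboundary ⊔ LinearMap.range M.faceCoboundary = M.antisymm := by
  have := Fintype.ofFinite V
  have := Fintype.ofFinite D
  have := Fintype.ofFinite F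
  obtain ⟨hconn, heuler⟩ := hM
  refine Submodule.eq_of_le_of_finrank_le
    (sup_le M.range_vertexCoboundary_le_antisymm M.range_faceCoboundary_le_antisymm) ?_
  have hsup := Submodule.finrank_sup_add_finrank_inf_eq
    (LinearMap.range M.vertexCoboundary) (LinearMap.range M.faceCoboundary)
  rw [(M.disjoint_range_vertexCoboundary_ker_divergence.mono_right
    M.range_faceCoboundary_le_ker_divergence).eq_bot, finrank_bot] at hsup
  have hV := M.vertexCoboundary.finrank_range_add_finrank_ker
  have hF := M.faceCoboundary.finrank_range_add_finrank_ker
  have hkerV := M.finrank_ker_vertexCoboundary_le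
  have hkerF := finrank_ker_faceCoboundary_le_one hconn
  have hD := M.two_mul_finrank_antisymm_le
  rw [Module.finrank_fintype_fun_eq_card, ← Nat.card_eq_fintype_card] at hV hF
  rw [← Nat.card_eq_fintype_card] at hD
  lia

/-- Every circulation comes from a potential on the faces, that is, the first homology of the
surface vanishes. Unlike Euler's formula, this property passes to the extended graph without any
counting. -/
def HasPotentials [Fintype D] : Prop :=
  ∀ f : D → ℝ, M.divergence f = 0 →
    ∃ φ : F → ℝ, ∀ d, M.net f d = φ (M.left d) - φ (M.right d)

variable {M} in
theorem IsPlanar.hasPotentials [Finite V] [Fintype D] [Finite F] (hM : M.IsPlanar) :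
    M.HasPotentials := by
  intro f hf
  have hdiv : M.net f ∈ LinearMap.ker M.divergence := by
    rw [LinearMap.mem_ker, divergence_of_mem_antisymm (M.net_mem_antisymm f)]
    ext v
    simp [← divergence_eq_outflow_net, hf]
  have hmem : M.net f ∈ LinearMap.range M.faceCoboundary := by
    have hmodular := sup_inf_assoc_of_le (LinearMap.range M.vertexCoboundary)
      M.range_faceCoboundary_le_ker_divergence
    rw [M.disjoint_range_vertexCoboundary_ker_divergence.eq_bot, sup_bot_eq, sup_comm,
      hM.range_vertexCoboundary_sup_range_faceCoboundary] at hmodular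
    exact hmodular ▸ ⟨M.net_mem_antisymm f, hdiv⟩
  obtain ⟨φ, hφ⟩ := hmem
  exact ⟨φ, fun d => (congrFun hφ d).symm⟩

/-! ### Reachability and cycles -/

/-- Some dart of `S` leads from `u` to `v`. -/
def AdjIn (S : Set D) (u v : V) : Prop := ∃ d ∈ S, M.src d = u ∧ M.tgt d = v

/-- There is a directed walk of darts of `S` from `u` to `v`. -/
def Reaches (S : Set D) : V → V → Prop := Relation.ReflTransGen (M.AdjIn S)

variable {M} in
lemma adjIn_of_mem {S : Set D} {d : D} (hd : d ∈ S) : M.AdjIn S (M.src d) (M.tgt d) :=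
  ⟨d, hd, rfl, rfl⟩

variable {M} in
lemma Reaches.exists_unit_flow [Fintype D] [DecidableEq V] {S : Set D} {u w : V}
    (h : M.Reaches S u w) :
    ∃ k : D → ℝ, 0 ≤ k ∧ (∀ d ∉ S, k d = 0) ∧
      M.divergence k = Pi.single u 1 - Pi.single w 1 := by
  classical
  induction h with
  | refl => exact ⟨0, le_rfl, fun _ _ => rfl, by rw [map_zero, sub_self]⟩
  | tail _ hstep ih =>
    obtain ⟨k, hk_nonneg, hk_off, hk_div⟩ := ih
    obtain ⟨d, hd, rfl, rfl⟩ := hstep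
    refine ⟨k + Pi.single d 1, add_nonneg hk_nonneg (Pi.single_nonneg.2 zero_le_one),
      fun e he => ?_, ?_⟩
    · rw [Pi.add_apply, hk_off e he, Pi.single_eq_of_ne (ne_of_mem_of_not_mem hd he).symm,
        add_zero]
    · rw [map_add, hk_div, divergence_single, sub_add_sub_cancel]

variable {M} in
lemma exists_pos_circulation [Fintype D] {S : Set D}
    (hS : ∀ d ∈ S, M.Reaches S (M.tgt d) (M.src d)) :
    ∃ k : D → ℝ, (∀ d ∈ S, 0 < k d) ∧ (∀ d ∉ S, k d = 0) ∧ M.divergence k = 0 := by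
  classical
  choose k hk_nonneg hk_off hk_div using fun d : S => (hS d d.2).exists_unit_flow
  refine ⟨∑ d : S, (k d + Pi.single d.1 1), fun e he => ?_, fun e he => ?_, ?_⟩
  · rw [Finset.sum_apply]
    refine Finset.sum_pos' (fun d _ => ?_) ⟨⟨e, he⟩, Finset.mem_univ _, ?_⟩
    · exact add_nonneg (hk_nonneg d) (Pi.single_nonneg.2 zero_le_one) e
    · rw [Pi.add_apply, Pi.single_eq_same]
      exact add_pos_of_nonneg_of_pos (hk_nonneg _ e) one_pos
  · rw [Finset.sum_apply]
    refine Finset.sum_eq_zero fun d _ => ?_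
    rw [Pi.add_apply, hk_off d e he, Pi.single_eq_of_ne (ne_of_mem_of_not_mem d.2 he).symm,
      add_zero]
  · rw [map_sum]
    refine Finset.sum_eq_zero fun d _ => ?_
    rw [map_add, hk_div, divergence_single, sub_add_sub_cancel, sub_self]

variable {M} in
lemma HasPotentials.exists_strict_potential [Fintype D] (hM : M.HasPotentials) {S : Set D}
    (hS : ∀ d ∈ S, M.Reaches S (M.tgt d) (M.src d)) :
    ∃ φ : F → ℝ, (∀ d, d ∉ S → M.rev d ∉ S → φ (M.left d) = φ (M.right d)) ∧
      ∀ d ∈ S, M.rev d ∉ S → φ (M.right d) < φ (M.left d) := by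
  obtain ⟨k, hk_pos, hk_off, hk_div⟩ := exists_pos_circulation hS
  obtain ⟨φ, hφ⟩ := hM k hk_div
  refine ⟨φ, fun d hd hd' => ?_, fun d hd hd' => ?_⟩
  · rw [← sub_eq_zero, ← hφ, net, hk_off d hd, hk_off _ hd', sub_zero]
  · rw [← sub_pos, ← hφ, net, hk_off _ hd', sub_zero]
    exact hk_pos d hd

variable {M} in
lemma IsCycle.reaches {k : ℕ} {C : Fin (k + 1) → D} (hC : M.IsCycle C) {S : Set D}
    (hCS : ∀ i, C i ∈ S) (i j : Fin (k + 1)) : M.Reaches S (M.src (C i)) (M.src (C j)) := by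
  suffices ∀ n : ℕ, M.Reaches S (M.src (C i)) (M.src (C (i + Fin.ofNat (k + 1) n))) by
    simpa using this (j - i : Fin (k + 1)).val
  intro n
  induction n with
  | zero =>
    simp only [Fin.ofNat_zero, add_zero]
    exact Relation.ReflTransGen.refl
  | succ n ih =>
    refine ih.tail ⟨_, hCS _, rfl, ?_⟩
    rw [hC.1, add_assoc]
    congr 3
    ext
    simp [Fin.val_add]

variable {M} in
lemma exists_isCycle [Finite D] {B : Set D} (hne : B.Nonempty)
    (hB : ∀ d ∈ B, ∃ e ∈ B, M.src e = M.tgt d) :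
    ∃ (k : ℕ) (C : Fin (k + 1) → D), M.IsCycle C ∧ ∀ i, C i ∈ B := by
  have : Nonempty (M.src '' B) := (hne.image M.src).to_subtype
  choose g hgB hgs using fun w : M.src '' B => w.2
  let step : M.src '' B → M.src '' B := fun w => ⟨M.tgt (g w), hB _ (hgB w)⟩
  obtain ⟨w, hw⟩ := exists_mem_periodicPts_of_finite step
  obtain ⟨k, hk⟩ := Nat.exists_eq_add_one.2 (Function.minimalPeriod_pos_of_mem_periodicPts hw)
  refine ⟨k, fun i => g (step^[i] w), ⟨fun i => ?_, fun i j hij => ?_⟩, fun i => hgB _⟩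
  · have hnext : step (step^[i] w) = step^[(i + 1 : Fin (k + 1))] w := by
      rw [← Function.iterate_succ_apply' step, Fin.val_add,
        ← Function.iterate_mod_minimalPeriod_eq (n := (i : ℕ) + 1), hk]
      simp
    rw [hgs, ← hnext]
  · have heq : step^[i] w = step^[j] w := Subtype.ext (by simpa only [hgs] using hij)
    exact Fin.ext <| (Function.iterate_eq_iterate_iff_of_lt_minimalPeriod
      (i.2.trans_eq hk.symm) (j.2.trans_eq hk.symm)).1 heq

/-! ### Clockwise cycles -/

variable {M} in
lemma exists_src_eq_left_mem_right_notMem [Finite D] {A : Set F} {d : D}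
    (hright : M.right d ∈ A) (hleft : M.left d ∉ A) :
    ∃ e, M.src e = M.src d ∧ M.left e ∈ A ∧ M.right e ∉ A := by
  by_contra! hno
  have hrot : M.left (M.rot.symm d) ∉ A := by
    refine rot_induction (M := M) (p := fun e => M.left e ∉ A) (fun x hx hp hmem => ?_) hleft ?_
    · exact hp (by simpa using hno _ ((M.src_rot x).trans hx) hmem)
    · rw [← M.src_rot, Equiv.apply_symm_apply]
  rw [← right_rot, Equiv.apply_symm_apply] at hrot
  exact hrot hright

variable {M} in
lemma exists_boundary_isCycle [Finite D] {A : Set F}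
    (hA : ∃ d, M.left d ∈ A ∧ M.right d ∉ A) :
    ∃ (k : ℕ) (C : Fin (k + 1) → D),
      M.IsCycle C ∧ ∀ i, M.left (C i) ∈ A ∧ M.right (C i) ∉ A := by
  refine exists_isCycle hA fun d ⟨hleft, hright⟩ => ?_
  obtain ⟨e, hsrc, he⟩ := exists_src_eq_left_mem_right_notMem (d := M.rev d)
    (by rwa [right_rev]) (by rwa [left_rev])
  exact ⟨e, he, hsrc⟩

variable {M} in
lemma IsCycle.isClockwise [Fintype D] (hM : M.HasPotentials) {k : ℕ} {C : Fin (k + 1) → D}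
    (hC : M.IsCycle C) (hrev : ∀ i, M.rev (C i) ∉ Set.range C)
    (hleft : ∀ i,
      Relation.ReflTransGen (M.DualAdjAvoiding (Set.range C)) M.outer (M.left (C i))) :
    M.IsClockwise C := by
  obtain ⟨φ, hφ_eq, hφ_lt⟩ := hM.exists_strict_potential (S := Set.range C) <| by
    rintro _ ⟨i, rfl⟩
    rw [hC.1]
    exact hC.reaches Set.mem_range_self _ _
  refine ⟨hC, fun i hright => (hφ_lt (C i) ⟨i, rfl⟩ (hrev i)).ne ?_⟩
  rw [← eq_of_reflTransGen_dualAdjAvoiding hφ_eq hright,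
    eq_of_reflTransGen_dualAdjAvoiding hφ_eq (hleft i)]

/-- Some dart outside of `S` has the face `a` on its left and the face `b` on its right. -/
def DualArcAvoiding (S : Set D) (a b : F) : Prop := ∃ d ∉ S, M.left d = a ∧ M.right d = b

variable {M} in
theorem HasPotentials.reflTransGen_dualArcAvoiding [Fintype D] (hM : M.HasPotentials)
    (hconn : ∀ a, Relation.ReflTransGen (M.DualAdjAvoiding ∅) M.outer a) {S : Set D}
    (hS : ∀ (k : ℕ) (C : Fin (k + 1) → D), (∀ i, C i ∈ S) → ¬ M.IsClockwise C) (a : F) :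
    Relation.ReflTransGen (M.DualArcAvoiding S) M.outer a := by
  set R : Set F := {b | Relation.ReflTransGen (M.DualArcAvoiding S) M.outer b}
  have hmem_of_boundary (d : D) (hd : M.left d ∈ R ∧ M.right d ∉ R) : d ∈ S := by
    by_contra hdS
    exact hd.2 (hd.1.tail ⟨d, hdS, rfl, rfl⟩)
  by_cases hboundary : ∃ d, M.left d ∈ R ∧ M.right d ∉ R
  · obtain ⟨k, C, hC, hCR⟩ := exists_boundary_isCycle hboundary
    have hreach {b : F} (hb : b ∈ R) :
        Relation.ReflTransGen (M.DualAdjAvoiding (Set.range C)) M.outer b := by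
      induction hb with
      | refl => exact Relation.ReflTransGen.refl
      | tail h hstep ih =>
        obtain ⟨d, hd, rfl, rfl⟩ := hstep
        refine ih.tail ⟨d, ?_, ?_, rfl, rfl⟩
        · rintro ⟨i, rfl⟩
          exact hd (hmem_of_boundary _ (hCR i))
        · rintro ⟨i, hi⟩
          exact (hCR i).2 (by rwa [hi, right_rev])
    refine absurd (hC.isClockwise hM ?_ fun i => hreach (hCR i).1)
      (hS k C fun i => hmem_of_boundary _ (hCR i))
    rintro i ⟨j, hj⟩
    exact (hCR i).2 (by rw [← left_rev, ← hj]; exact (hCR j).1)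
  · push Not at hboundary
    induction hconn a with
    | refl => exact Relation.ReflTransGen.refl
    | tail _ hstep ih =>
      obtain ⟨d, -, -, rfl, rfl⟩ := hstep
      exact hboundary d ih

variable {M} in
lemma HasPotentials.outer_mem [Fintype D] (hM : M.HasPotentials)
    (hconn : ∀ a, Relation.ReflTransGen (M.DualAdjAvoiding ∅) M.outer a) {S : Set D}
    (hS : ∀ (k : ℕ) (C : Fin (k + 1) → D), (∀ i, C i ∈ S) → ¬ M.IsClockwise C) {A : Set F}
    (hne : A.Nonempty) (hA : ∀ d ∉ S, M.right d ∈ A → M.left d ∈ A) : M.outer ∈ A := by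
  obtain ⟨a, ha⟩ := hne
  induction hM.reflTransGen_dualArcAvoiding hconn hS a with
  | refl => exact ha
  | tail _ hstep ih =>
    obtain ⟨d, hd, rfl, rfl⟩ := hstep
    exact ih (hA d hd ha)

/-! ### Counterclockwise regions -/

/-- The strongly connected component of `r` in the graph formed by the darts of `S`. -/
def component (S : Set D) (r : V) : Set V := {v | M.Reaches S r v ∧ M.Reaches S v r}

/-- The darts of `S` within the strongly connected component of `r`. -/
def componentDarts (S : Set D) (r : V) : Set D :=
  {d | d ∈ S ∧ M.src d ∈ M.component S r ∧ M.tgt d ∈ M.component S r}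

variable {M} in
lemma reaches_componentDarts {S : Set D} {r u w : V} (hu : u ∈ M.component S r)
    (hw : w ∈ M.component S r) : M.Reaches (M.componentDarts S r) u w := by
  have huw : M.Reaches S u w := hu.2.trans hw.1
  induction huw using Relation.ReflTransGen.head_induction_on with
  | refl => exact Relation.ReflTransGen.refl
  | head hstep hrest ih =>
    have hv := And.intro (hu.1.tail hstep) (hrest.trans hw.2)
    obtain ⟨d, hd, rfl, rfl⟩ := hstep
    exact (ih hv).head (adjIn_of_mem ⟨hd, hu, hv⟩)

variable {M} in
lemma IsCycle.mem_componentDarts {k : ℕ} {C : Fin (k + 1) → D} (hC : M.IsCycle C) {S : Set D}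
    (hCS : ∀ i, C i ∈ S) (i : Fin (k + 1)) : C i ∈ M.componentDarts S (M.src (C 0)) := by
  have hmem (j : Fin (k + 1)) : M.src (C j) ∈ M.component S (M.src (C 0)) :=
    ⟨hC.reaches hCS 0 j, hC.reaches hCS j 0⟩
  refine ⟨hCS i, hmem i, ?_⟩
  rw [hC.1]
  exact hmem (i + 1)

/-- A nonempty set of bounded faces that can only be left by crossing a dart of `S` from left to
right, and that does not lie on the right of a dart of `S` unless the reverse dart is in `S`. -/
structure IsCcwRegion (S : Set D) (Ψ : Set F) : Prop where
  outer_notMem : M.outer ∉ Ψ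
  nonempty : Ψ.Nonempty
  notMem_and_left_mem : ∀ d, M.rev d ∉ S → M.right d ∈ Ψ → d ∉ S ∧ M.left d ∈ Ψ

variable {M} in
theorem HasPotentials.exists_isCcwRegion [Fintype D] [Finite F] (hM : M.HasPotentials) {S : Set D}
    (hS : ∀ d ∈ S, M.Reaches S (M.tgt d) (M.src d)) {k : ℕ} {C : Fin (k + 1) → D}
    (hC : M.IsCounterclockwise C) (hCS : ∀ i, C i ∈ S) : ∃ Ψ, M.IsCcwRegion S Ψ := by
  obtain ⟨φ, hφ_eq, hφ_lt⟩ := hM.exists_strict_potential hS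
  obtain ⟨b, hb, hmax⟩ :=
    Set.exists_max_image {a | M.Encloses C a} φ (Set.toFinite _) ⟨_, hC.2 0⟩
  refine ⟨{a | M.Encloses C a ∧ φ a = φ b}, fun h => h.1 Relation.ReflTransGen.refl,
    ⟨b, hb, rfl⟩, ?_⟩
  rintro d hrev ⟨hright, hφ⟩
  have hrev_range : M.rev d ∉ Set.range C := fun ⟨i, hi⟩ => hrev (hi ▸ hCS i)
  have hleft : M.Encloses C (M.left d) := by
    by_cases hd : d ∈ Set.range C
    · obtain ⟨i, rfl⟩ := hd
      exact hC.2 i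
    · exact fun h => hright (h.tail ⟨d, hd, hrev_range, rfl, rfl⟩)
  have hd : d ∉ S := fun hd => ((hφ_lt d hd hrev).trans_le (hmax _ hleft)).ne hφ
  exact ⟨hd, hleft, (hφ_eq d hd hrev).trans hφ⟩

namespace IsCcwRegion

variable {M} {S : Set D} {Ψ : Set F} (hΨ : M.IsCcwRegion S Ψ)

include hΨ

lemma left_mem_of_isolated [Finite D] {d e : D} (hS : ∀ x ∈ S, M.tgt x ≠ M.src d)
    (hd : M.left d ∈ Ψ) (he : M.src e = M.src d) : M.left e ∈ Ψ := by
  refine rot_induction (p := fun e => M.left e ∈ Ψ) (fun x hx hp => ?_) hd he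
  refine (hΨ.notMem_and_left_mem (M.rot x) (fun h => hS _ h ?_) (by rwa [right_rot])).2
  rw [tgt_rev, src_rot, hx]

lemma left_mem_of_tgt_isolated [Finite D] {d e : D} (hS : ∀ x ∈ S, M.tgt x ≠ M.tgt d)
    (hd : M.left d ∈ Ψ) (he : M.src e = M.tgt d) : M.left e ∈ Ψ := by
  refine hΨ.left_mem_of_isolated (d := M.rev d) hS ?_ he
  refine (hΨ.notMem_and_left_mem (M.rev d) (fun h => ?_) (by rwa [right_rev])).2
  rw [M.rev_rev] at h
  exact hS d h rfl

end IsCcwRegion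

variable {M} in
lemma exists_divergence_neg [Finite V] [Fintype D] {g : D → ℝ} (hg : ∀ d, 0 ≤ g d) {U : Set V}
    (hU : ∀ d, 0 < g d → M.src d ∈ U → M.tgt d ∈ U) {x : D} (hx : 0 < g x)
    (hsrc : M.src x ∉ U) (htgt : M.tgt x ∈ U) : ∃ v ∈ U, M.divergence g v < 0 := by
  have := Fintype.ofFinite V
  have hnonpos (d : D) : g d * M.vertexCoboundary (U.indicator 1) d ≤ 0 := by
    rcases (hg d).eq_or_lt with hd | hd
    · rw [← hd, zero_mul]
    · rw [vertexCoboundary_apply]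
      refine mul_nonpos_of_nonneg_of_nonpos hd.le (sub_nonpos.2 ?_)
      by_cases hdU : M.src d ∈ U
      · simp [hdU, hU d hd hdU]
      · rw [Set.indicator_of_notMem hdU]
        exact Set.indicator_nonneg (fun _ _ => zero_le_one) _
  have hneg : ∑ d, g d * M.vertexCoboundary (U.indicator 1) d < 0 :=
    Finset.sum_neg' (fun d _ => hnonpos d) ⟨x, Finset.mem_univ x, by
      simpa [vertexCoboundary_apply, hsrc, htgt] using hx⟩
  rw [sum_mul_vertexCoboundary] at hneg
  by_contra! hnonneg
  refine hneg.not_ge (Finset.sum_nonneg fun v _ => ?_)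
  by_cases hv : v ∈ U <;> simp [hv, hnonneg v]

variable {M} in
theorem IsCcwRegion.tgt_mem_component [Finite V] [Fintype D] {g : D → ℝ} (hg : ∀ d, 0 ≤ g d)
    (hsink : ∀ d, 0 < g d →
      M.divergence g (M.tgt d) = 0 ∨ ∃ e, M.src e = M.tgt d ∧ M.left e = M.outer)
    {r : V} {Ψ : Set F} (hΨ : M.IsCcwRegion (M.componentDarts {d | 0 < g d} r) Ψ) {x : D}
    (hx : 0 < g x) (hsrc : M.src x ∈ M.component {d | 0 < g d} r) (hleft : M.left x ∈ Ψ) :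
    M.tgt x ∈ M.component {d | 0 < g d} r := by
  by_contra htgt
  set U : Set V := {w | M.Reaches {d | 0 < g d} (M.tgt x) w}
  have hdisjoint (w : V) (hw : w ∈ U) : w ∉ M.component {d | 0 < g d} r := fun hwr =>
    htgt ⟨hsrc.1.tail (adjIn_of_mem hx), hw.trans hwr.2⟩
  have hfaces (d : D) (hd : M.tgt d ∈ U) (hl : M.left d ∈ Ψ) (e : D) (he : M.src e = M.tgt d) :
      M.left e ∈ Ψ :=
    hΨ.left_mem_of_tgt_isolated (fun y hy heq => hdisjoint _ hd (heq ▸ hy.2.2)) hl he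
  have hU (w : V) (hw : w ∈ U) :
      (∃ d, 0 < g d ∧ M.tgt d = w) ∧ ∀ e, M.src e = w → M.left e ∈ Ψ := by
    induction hw with
    | refl => exact ⟨⟨x, hx, rfl⟩, hfaces x .refl hleft⟩
    | tail hw hstep ih =>
      obtain ⟨d, hd, rfl, rfl⟩ := hstep
      exact ⟨⟨d, hd, rfl⟩, hfaces d (hw.tail (adjIn_of_mem hd)) (ih.2 d rfl)⟩
  obtain ⟨w, hw, hneg⟩ := exists_divergence_neg hg (U := U)
    (fun d hd hmem => hmem.tail (adjIn_of_mem hd)) hx (fun h => hdisjoint _ h hsrc) .refl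
  obtain ⟨⟨d, hd, rfl⟩, hleft_mem⟩ := hU w hw
  rcases hsink d hd with hzero | ⟨e, he, houter⟩
  · exact hneg.ne hzero
  · exact hΨ.outer_notMem (houter ▸ hleft_mem e he)

end EmbeddedGraph

namespace EmbeddedGraph

variable {V D F : Type*} {M : EmbeddedGraph V D F}

lemma IsFlow.saturated [Fintype D] {c : D → ℝ≥0∞} {s t : V} {f : D → ℝ} (hf : M.IsFlow c s t f)
    {d : D} (hd : ¬ 0 < M.resCap c f d) : c d = ENNReal.ofReal (f d) ∧ f (M.rev d) = 0 := by
  have htop : c d ≠ ⊤ := fun h => hd (by simp [resCap, h])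
  have hle : f d ≤ (c d).toReal := (ENNReal.ofReal_le_iff_le_toReal htop).1 (hf.1 d).2
  have hres : (c d).toReal - f d + f (M.rev d) ≤ 0 := by
    rw [not_lt, resCap, ← EReal.coe_ennreal_toReal htop] at hd
    exact_mod_cast hd
  have hrev := (hf.1 (M.rev d)).1
  have heq : f d = (c d).toReal := by linarith
  exact ⟨by rw [heq, ENNReal.ofReal_toReal htop], by linarith⟩

end EmbeddedGraph

namespace PlanarNetwork

variable {V D F : Type*} (N : PlanarNetwork V D F)

/-! ### The extended graph -/

variable {N} in
lemma finRot_induction [Finite D] {p : N.FinDart → Prop} {a b : N.FinDart}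
    (hp : ∀ x : N.FinDart, N.src x.1 = N.src a.1 → p x → p (N.finRot x)) (ha : p a)
    (hb : N.src b.1 = N.src a.1) : p b := by
  refine EmbeddedGraph.rot_induction (M := N.toEmbeddedGraph)
    (p := fun d => ∀ h : N.vcap (N.src d) ≠ ⊤, p ⟨d, h⟩) (fun d hd hpd h => ?_)
    (fun _ => ha) hb b.2
  have hfin : N.vcap (N.src d) ≠ ⊤ := by rwa [← N.src_rot]
  exact hp ⟨d, hfin⟩ hd (hpd hfin)

lemma extSrc_inl_eq_inl_iff {d : D} {v : V} (h : N.vcap v = ⊤) :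
    N.extSrc (Sum.inl d) = Sum.inl ⟨v, h⟩ ↔ N.src d = v := by
  by_cases hd : N.vcap (N.src d) = ⊤
  · simp [extSrc, hd]
  · simp only [extSrc, hd, dif_neg, not_false_eq_true, reduceCtorEq, false_iff]
    rintro rfl
    exact hd h

lemma extSrc_inl_eq_inr_iff {d : D} {a : N.FinDart} :
    N.extSrc (Sum.inl d) = Sum.inr a ↔ d = a.1 := by
  by_cases hd : N.vcap (N.src d) = ⊤
  · simp only [extSrc, hd, dif_pos, reduceCtorEq, false_iff]
    rintro rfl
    exact a.2 hd
  · simp [extSrc, hd, Subtype.ext_iff]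

lemma outflow_extGraph_inl [Fintype D] (x : N.ExtDart → ℝ) {v : V} (h : N.vcap v = ⊤) :
    N.extGraph.outflow x (Sum.inl ⟨v, h⟩) = N.outflow (N.restrict x) v := by
  classical
  have hring (a : N.FinDart) (b : Bool) : N.extSrc (Sum.inr (a, b)) ≠ Sum.inl ⟨v, h⟩ := by
    cases b <;> exact Sum.inr_ne_inl
  have hsrc (e : N.ExtDart) : N.extGraph.src e = N.extSrc e := rfl
  rw [EmbeddedGraph.outflow, EmbeddedGraph.outflow, Finset.sum_filter, Finset.sum_filter,
    Fintype.sum_sum_type]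
  simp only [hsrc, extSrc_inl_eq_inl_iff, hring, if_false, Finset.sum_const_zero, add_zero,
    restrict]

lemma outflow_extGraph_inr_finRot [Fintype D] (x : N.ExtDart → ℝ) (a : N.FinDart) :
    N.extGraph.outflow x (Sum.inr (N.finRot a)) =
      x (Sum.inl (N.rot a.1)) + x (Sum.inr (N.finRot a, true)) + x (Sum.inr (a, false)) := by
  classical
  have hinj : Function.Injective N.finRot :=
    Function.LeftInverse.injective N.finRotSymm_finRot
  have hinl (d : D) : N.extGraph.src (Sum.inl d) = Sum.inr (N.finRot a) ↔ d = N.rot a.1 :=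
    N.extSrc_inl_eq_inr_iff
  have htrue (b : N.FinDart) :
      N.extGraph.src (Sum.inr (b, true)) = Sum.inr (N.finRot a) ↔ b = N.finRot a :=
    Sum.inr_injective.eq_iff
  have hfalse (b : N.FinDart) :
      N.extGraph.src (Sum.inr (b, false)) = Sum.inr (N.finRot a) ↔ b = a :=
    Sum.inr_injective.eq_iff.trans hinj.eq_iff
  rw [EmbeddedGraph.outflow, Finset.sum_filter, Fintype.sum_sum_type, Fintype.sum_prod_type]
  simp only [Fintype.sum_bool, hinl, htrue, hfalse, Finset.sum_add_distrib, Finset.sum_ite_eq',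
    Finset.mem_univ, if_true, add_assoc]

/-- The net flow from the vertex of `a` to the next vertex in counterclockwise order on `C_v`. -/
noncomputable def ringFlow (f : N.ExtDart → ℝ) (a : N.FinDart) : ℝ :=
  N.extGraph.net f (Sum.inr (a, true))

lemma net_extGraph_false (f : N.ExtDart → ℝ) (a : N.FinDart) :
    N.extGraph.net f (Sum.inr (a, false)) = -N.ringFlow f a :=
  N.extGraph.net_mem_antisymm f (Sum.inr (a, true))

lemma divergence_extGraph_inl [Fintype D] (f : N.ExtDart → ℝ) {v : V} (h : N.vcap v = ⊤) :
    N.extGraph.divergence f (Sum.inl ⟨v, h⟩) = N.divergence (N.restrict f) v := by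
  rw [EmbeddedGraph.divergence_eq_outflow_net, outflow_extGraph_inl,
    EmbeddedGraph.divergence_eq_outflow_net]
  rfl

lemma divergence_extGraph_inr_finRot [Fintype D] (f : N.ExtDart → ℝ) (a : N.FinDart) :
    N.extGraph.divergence f (Sum.inr (N.finRot a)) =
      N.net (N.restrict f) (N.rot a.1) + N.ringFlow f (N.finRot a) - N.ringFlow f a := by
  rw [EmbeddedGraph.divergence_eq_outflow_net, outflow_extGraph_inr_finRot, net_extGraph_false,
    ← sub_eq_add_neg]
  rfl

/-- The map of vertices that contracts every cycle `C_v` to `v`. -/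
def collapse : N.ExtVertex → V := Sum.elim Subtype.val fun a => N.src a.1

variable {N} in
lemma divergence_restrict_eq_zero [Fintype D] {f : N.ExtDart → ℝ} {v : V}
    (hf : ∀ w, N.collapse w = v → N.extGraph.divergence f w = 0) :
    N.divergence (N.restrict f) v = 0 := by
  classical
  by_cases hv : N.vcap v = ⊤
  · rw [← N.divergence_extGraph_inl f hv]
    exact hf _ rfl
  let y : D → ℝ := fun d => if h : N.vcap (N.src d) ≠ ⊤ then N.ringFlow f ⟨d, h⟩ else 0
  have hy (a : N.FinDart) : y a.1 = N.ringFlow f a := dif_pos a.2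
  have hnet (d : D) (hd : N.src d = v) :
      (N.net (N.restrict f) ∘ N.rot) d = y d - y (N.rot d) := by
    let a : N.FinDart := ⟨d, by rwa [hd]⟩
    have hzero := hf (Sum.inr (N.finRot a)) ((N.src_rot d).trans hd)
    rw [divergence_extGraph_inr_finRot, ← hy, ← hy] at hzero
    change N.net (N.restrict f) (N.rot d) + y (N.rot d) - y d = 0 at hzero
    rw [Function.comp_apply]
    linear_combination hzero
  rw [N.divergence_eq_outflow_net, ← N.outflow_comp_rot, EmbeddedGraph.outflow,
    Finset.sum_congr rfl fun d hd => hnet d (Finset.mem_filter.1 hd).2, Finset.sum_sub_distrib,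
    sub_eq_zero]
  exact (N.outflow_comp_rot y v).symm

variable {N} in
theorem hasPotentials_extGraph [Fintype D] (hN : N.HasPotentials) :
    N.extGraph.HasPotentials := by
  intro f hf
  obtain ⟨φ, hφ⟩ := hN (N.restrict f) <| funext fun v =>
    divergence_restrict_eq_zero fun w _ => congrFun hf w
  have hrot (a : N.FinDart) :
      N.ringFlow f (N.finRot a) + φ (N.left (N.rot a.1)) = N.ringFlow f a + φ (N.left a.1) := by
    have hzero := congrFun hf (Sum.inr (N.finRot a))
    rw [divergence_extGraph_inr_finRot, hφ, N.right_rot, Pi.zero_apply] at hzero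
    linear_combination hzero
  have hconst (a b : N.FinDart) (hab : N.src b.1 = N.src a.1) :
      N.ringFlow f b + φ (N.left b.1) = N.ringFlow f a + φ (N.left a.1) :=
    finRot_induction (p := fun x => N.ringFlow f x + φ (N.left x.1) = _)
      (fun x _ hx => (hrot x).trans hx) rfl hab
  have hdisc (w : {v : V // N.vcap v ≠ ⊤ ∧ ∃ d, N.src d = v}) :
      ∃ a : N.FinDart, N.src a.1 = w.1 := by
    obtain ⟨_, h, d, rfl⟩ := w
    exact ⟨⟨d, h⟩, rfl⟩
  choose g hg using hdisc
  let ψ : N.ExtFace → ℝ := Sum.elim φ fun w => N.ringFlow f (g w) + φ (N.left (g w).1)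
  have hring (a : N.FinDart) :
      N.ringFlow f a = ψ (N.extLeft (Sum.inr (a, true))) - φ (N.left a.1) :=
    eq_sub_of_add_eq (hconst _ a (hg ⟨N.src a.1, a.2, a.1, rfl⟩).symm)
  refine ⟨ψ, ?_⟩
  rintro (d | ⟨a, _ | _⟩)
  · exact hφ d
  · rw [net_extGraph_false, hring, neg_sub]
    rfl
  · exact hring a

lemma extGraph_dual_connected (a : N.ExtFace) :
    Relation.ReflTransGen (N.extGraph.DualAdjAvoiding ∅) N.extGraph.outer a := by
  have hinl (b : F) : Relation.ReflTransGen (N.extGraph.DualAdjAvoiding ∅)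
      N.extGraph.outer (Sum.inl b) := by
    refine (N.isPlanar.1 N.outer b).lift Sum.inl ?_
    rintro _ _ ⟨d, -, -, rfl, rfl⟩
    exact ⟨Sum.inl d, Set.notMem_empty _, Set.notMem_empty _, rfl, rfl⟩
  rcases a with b | ⟨_, h, d, rfl⟩
  · exact hinl b
  · exact (hinl (N.left d)).tail
      ⟨Sum.inr (⟨d, h⟩, false), Set.notMem_empty _, Set.notMem_empty _, rfl, rfl⟩

/-! ### Flows in the extended graph -/

/-- The set `Ψ` of faces together with the discs inside the cycles `C_v` that it surrounds. -/
def extRegion (Ψ : Set F) : Set N.ExtFace :=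
  {x | Sum.elim (· ∈ Ψ) (fun v => ∀ d, N.src d = v.1 → N.left d ∈ Ψ) x}

section Flow

variable {N} [Fintype D] {c : N.ExtDart → ℝ≥0∞} {f : N.ExtDart → ℝ}
  (hc : ∀ d ∉ N.arcs, c (Sum.inl d) = 0) (hf : N.extGraph.IsFlow c N.extS N.extT f)

include hc hf

lemma mem_arcs_of_restrict_pos {d : D} (hd : 0 < N.restrict f d) : d ∈ N.arcs := by
  by_contra h
  have hle := (hf.1 (Sum.inl d)).2
  rw [hc d h, nonpos_iff_eq_zero, ENNReal.ofReal_eq_zero] at hle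
  exact hle.not_gt hd

lemma divergence_restrict_tgt_eq_zero_or {d : D} (hd : 0 < N.restrict f d) :
    N.divergence (N.restrict f) (N.tgt d) = 0 ∨ ∃ e, N.src e = N.tgt d ∧ N.left e = N.outer := by
  by_cases ht : N.tgt d = N.t
  · rw [ht]
    exact Or.inr (N.t_outer ⟨N.rev d, ht⟩)
  · have hs := N.tgt_ne_s d (mem_arcs_of_restrict_pos hc hf hd)
    refine Or.inl (divergence_restrict_eq_zero fun w hw => hf.divergence_eq_zero ?_ ?_)
    · rintro rfl
      exact hs hw.symm
    · rintro rfl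
      exact ht hw.symm

variable [Finite V] {r : V} {Ψ : Set F}
  (hΨ : N.IsCcwRegion (N.componentDarts {d | 0 < N.restrict f d} r) Ψ)

include hΨ

lemma left_mem_of_ringFlow_maximal {a : N.FinDart}
    (hmax : ∀ b : N.FinDart, N.src b.1 = N.src a.1 → N.ringFlow f b ≤ N.ringFlow f a)
    (ha : N.left a.1 ∈ Ψ) {e : D} (he : N.src e = N.src a.1) : N.left e ∈ Ψ := by
  have hnonneg (d : D) : 0 ≤ N.restrict f d := (hf.1 (Sum.inl d)).1
  by_cases hcomp : N.src a.1 ∈ N.component {d | 0 < N.restrict f d} r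
  swap
  · exact hΨ.left_mem_of_isolated (fun x hx heq => hcomp (heq ▸ hx.2.2)) ha he
  suffices ∀ b : N.FinDart, N.src b.1 = N.src a.1 →
      N.ringFlow f a ≤ N.ringFlow f b ∧ N.left b.1 ∈ Ψ from
    (this ⟨e, he ▸ a.2⟩ he).2
  refine fun b => finRot_induction
    (p := fun b => N.ringFlow f a ≤ N.ringFlow f b ∧ N.left b.1 ∈ Ψ)
    (fun x hx ⟨hle, hleft⟩ => ?_) ⟨le_rfl, ha⟩
  have hsrc : N.src (N.rot x.1) = N.src a.1 := (N.src_rot _).trans hx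
  have hconserved : N.net (N.restrict f) (N.rot x.1) =
      N.ringFlow f x - N.ringFlow f (N.finRot x) := by
    have hzero := hf.divergence_eq_zero (v := Sum.inr (N.finRot x)) Sum.inr_ne_inl Sum.inr_ne_inl
    rw [divergence_extGraph_inr_finRot] at hzero
    linear_combination hzero
  have hnet : 0 ≤ N.net (N.restrict f) (N.rot x.1) :=
    hconserved ▸ sub_nonneg.2 ((hmax _ hsrc).trans hle)
  have hrev : ¬ 0 < N.restrict f (N.rev (N.rot x.1)) := fun hpos =>
    N.rev_notMem_of_vcap _
      (mem_arcs_of_restrict_pos hc hf (hpos.trans_le (sub_nonneg.1 hnet))) (hsrc ▸ a.2)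
      (mem_arcs_of_restrict_pos hc hf hpos)
  obtain ⟨hnotMem, hleft_rot⟩ := hΨ.notMem_and_left_mem (N.rot x.1) (fun h => hrev h.1)
    (by rwa [N.right_rot])
  have hzero : ¬ 0 < N.restrict f (N.rot x.1) := fun hpos => by
    have hmem := hsrc ▸ hcomp
    exact hnotMem ⟨hpos, hmem, hΨ.tgt_mem_component hnonneg
      (fun _ => divergence_restrict_tgt_eq_zero_or hc hf) hpos hmem hleft_rot⟩
  have hnet_nonpos : N.net (N.restrict f) (N.rot x.1) ≤ 0 :=
    (sub_le_self _ (hnonneg _)).trans (not_lt.1 hzero)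
  exact ⟨hle.trans (sub_nonpos.1 (hconserved ▸ hnet_nonpos)), hleft_rot⟩

lemma left_mem_extRegion
    (hring : ∀ a b : N.FinDart, N.src a.1 = N.src b.1 →
      c (Sum.inr (a, true)) = c (Sum.inr (b, true)))
    {e : N.ExtDart} (he : ¬ 0 < N.extGraph.resCap c f e)
    (hright : N.extGraph.right e ∈ N.extRegion Ψ) : N.extGraph.left e ∈ N.extRegion Ψ := by
  obtain ⟨hcap, hrev⟩ := hf.saturated he
  rcases e with d | ⟨a, _ | _⟩
  · exact (hΨ.notMem_and_left_mem d (fun h => h.1.ne' hrev) hright).2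
  · exact hright a.1 rfl
  · refine fun d hd => left_mem_of_ringFlow_maximal hc hf hΨ (fun b hb => ?_) hright hd
    have hle := (hf.1 (Sum.inr (b, true))).2
    rw [hring b a hb, hcap, ENNReal.ofReal_le_ofReal_iff (hf.1 _).1] at hle
    exact sub_le_sub hle (hrev.trans_le (hf.1 _).1)

end Flow

end PlanarNetwork

theorem mainTheorem4_general {V D F : Type*} [Finite V] [Fintype D] [Finite F]
    (N : PlanarNetwork V D F) (c : N.ExtDart → ℝ≥0∞) (f : N.ExtDart → ℝ)
    (hc : ∀ d ∉ N.arcs, c (Sum.inl d) = 0)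
    (hring : ∀ a b : N.FinDart, N.src a.1 = N.src b.1 →
      c (Sum.inr (a, true)) = c (Sum.inr (b, true)))
    (hf : N.extGraph.IsFlow c N.extS N.extT f)
    (hres : ∀ (k : ℕ) (C : Fin (k + 1) → N.ExtDart),
      (∀ i, 0 < N.extGraph.resCap c f (C i)) → ¬ N.extGraph.IsClockwise C) :
    ∀ (k : ℕ) (C : Fin (k + 1) → D),
      N.IsFlowCycle (N.restrict f) C → ¬ N.IsCounterclockwise C := by
  intro k C hflow hccw
  have hpot := N.isPlanar.hasPotentials
  obtain ⟨Ψ, hΨ⟩ := hpot.exists_isCcwRegion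
    (S := N.componentDarts {d | 0 < N.restrict f d} (N.src (C 0)))
    (fun d hd => EmbeddedGraph.reaches_componentDarts hd.2.2 hd.2.1) hccw
    (hccw.1.mem_componentDarts fun i => (hflow.2 i).2)
  refine hΨ.outer_notMem ?_
  exact (PlanarNetwork.hasPotentials_extGraph hpot).outer_mem (A := N.extRegion Ψ)
    (S := {e | 0 < N.extGraph.resCap c f e}) N.extGraph_dual_connected hres
    (hΨ.nonempty.image Sum.inl |>.mono (Set.image_subset_iff.2 fun _ ha => ha))
    fun _ he => PlanarNetwork.left_mem_extRegion hc hf hΨ hring he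

theorem mainTheorem4 {V D F : Type*} [Fintype V] [Fintype D] [Fintype F]
    (N : PlanarNetwork V D F) (f f' : N.ExtDart → ℝ)
    (hf : N.extGraph.IsFlow N.extCap N.extS N.extT f)
    (hf' : N.extGraph.IsFlow (N.cappedCap f) N.extS N.extT f')
    (hvalue : N.extGraph.inflow f' N.extT = N.extGraph.inflow f N.extT)
    (hres : ∀ (k : ℕ) (C : Fin (k + 1) → N.ExtDart),
      (∀ i, 0 < N.extGraph.resCap (N.cappedCap f) f' (C i)) → ¬ N.extGraph.IsClockwise C) :
    ∀ (k : ℕ) (C : Fin (k + 1) → D),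
      N.IsFlowCycle (N.restrict f') C → ¬ N.IsCounterclockwise C :=
  mainTheorem4_general N (N.cappedCap f) f' (fun d hd => by simp [PlanarNetwork.cappedCap, hd])
    (fun _ _ h => by simp [PlanarNetwork.cappedCap, h]) hf' hres
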